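/- Let $n\ge 1$, $0<\alpha<1$, $\omega>0$, $t_0\in\mathbb R$, and let $s_\omega(t)=t_0$ for $t_0\le t\le t_0+\omega$ and $s_\omega(t)=t-\omega$ for $t>t_0+\omega$. The short memory fractional derivative of a scalar function $g$ is $$\widetilde D^\alpha g(t)=\frac{1}{\Gamma(1-\alpha)}\int_{s_\omega(t)}^t (t-\tau)^{-\alpha}g'(\tau)\,d\tau ,$$ and it acts on vector functions componentwise. Let $f(x,t)\in\mathbb R^n$ be continuous in $(x,t)\in\mathbb R^n\times[t_0,\infty)$, with $f(0,t)=0$ for all $t\ge t_0$, and consider the system $$\widetilde D^\alpha x(t)=f(x(t),t),\qquad x(t_0)=x_0. \qquad (*)$$ A solution of $(*)$ is a function $x:[t_0,\infty)\to\mathbb R^n$ with $x(t_0)=x_0$ that is absolutely continuous on every compact subinterval and satisfies the system for almost every $t\ge t_0$. Suppose that there are a constant $\varphi>0$ and positive integers $m_1,\dots,m_n$ such that $$\sum_{i=1}^n x_i^{2^{m_i}-1}f_i(x,t)\le-\varphi\sum_{i=1}^n x_i^{2^{m_i}}\qquad\text{for all }x\in\mathbb R^n,\ t\ge t_0,$$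 and, with $\hat m=\min\{m_1,\dots,m_n\}$, $$\varphi\,2^{\hat m}>\frac{1}{\omega^\alpha\,\Gamma(1-\alpha)} .$$ Then the equilibrium point $0$ of $(*)$ is Lyapunov asymptotically stable, that is: 1. (stability) for every $\varepsilon>0$ there is $\delta>0$ such that every solution of $(*)$ with $\|x_0\|<\delta$ satisfies $\|x(t)\|<\varepsilon$ for all $t\ge t_0$; 2. (attractivity) there is $\eta>0$ such that every solution of $(*)$ with $\|x_0\|<\eta$ satisfies $x(t)\to0$ as $t\to\infty$. -/

import Mathlib

open MeasureTheory Filter Topology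

noncomputable section

/-- The lower limit of the memory window: `t₀` for `t ≤ t₀ + ω`, and `t - ω` afterwards. -/
def memoryStart (t₀ ω t : ℝ) : ℝ :=
  if t ≤ t₀ + ω then t₀ else t - ω

/-- The short memory fractional derivative of order `α` with memory length `ω` and initial
time `t₀`, of a scalar function `g`, at time `t`. -/
def shortMemoryDeriv (α ω t₀ : ℝ) (g : ℝ → ℝ) (t : ℝ) : ℝ :=
  1 / Real.Gamma (1 - α) *
    ∫ τ in memoryStart t₀ ω t..t, (t - τ) ^ (-α) * deriv g τ

/-- `x` is a solution on `[t₀, ∞)` of the short memory fractional system `D̃ x = f(x, t)`,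
`x(t₀) = x₀`. Each component is absolutely continuous on compact subintervals (so that its
derivative exists almost everywhere and is locally integrable up to `t₀`, where solutions
typically have an infinite slope), and the system holds, componentwise, at almost every time. -/
structure IsShortMemorySolution {n : ℕ} (α ω t₀ : ℝ)
    (f : EuclideanSpace ℝ (Fin n) → ℝ → EuclideanSpace ℝ (Fin n))
    (x₀ : EuclideanSpace ℝ (Fin n)) (x : ℝ → EuclideanSpace ℝ (Fin n)) : Prop where
  initial : x t₀ = x₀
  absolutelyContinuous : ∀ T : ℝ, t₀ ≤ T → ∀ i : Fin n,
    AbsolutelyContinuousOnInterval (fun t => x t i) t₀ T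
  equation : ∀ᵐ t : ℝ, t₀ ≤ t → ∀ i : Fin n,
    shortMemoryDeriv α ω t₀ (fun τ => x τ i) t = f (x t) t i

/-- `p` is an equilibrium point of the system with right-hand side `f` on `[t₀, ∞)`. -/
def IsEquilibriumPoint {n : ℕ} (t₀ : ℝ)
    (f : EuclideanSpace ℝ (Fin n) → ℝ → EuclideanSpace ℝ (Fin n))
    (p : EuclideanSpace ℝ (Fin n)) : Prop :=
  ∀ t : ℝ, t₀ ≤ t → f p t = 0

/-- Lyapunov stability of `p`: solutions that start close to `p` stay close to `p`. -/
def IsLyapunovStable {n : ℕ} (α ω t₀ : ℝ)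
    (f : EuclideanSpace ℝ (Fin n) → ℝ → EuclideanSpace ℝ (Fin n))
    (p : EuclideanSpace ℝ (Fin n)) : Prop :=
  ∀ ε : ℝ, 0 < ε → ∃ δ : ℝ, 0 < δ ∧
    ∀ (x₀ : EuclideanSpace ℝ (Fin n)) (x : ℝ → EuclideanSpace ℝ (Fin n)),
      IsShortMemorySolution α ω t₀ f x₀ x → ‖x₀ - p‖ < δ →
        ∀ t : ℝ, t₀ ≤ t → ‖x t - p‖ < ε

/-- Attractivity of `p`: solutions that start close enough to `p` converge to `p`. -/
def IsAttractive {n : ℕ} (α ω t₀ : ℝ)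
    (f : EuclideanSpace ℝ (Fin n) → ℝ → EuclideanSpace ℝ (Fin n))
    (p : EuclideanSpace ℝ (Fin n)) : Prop :=
  ∃ η : ℝ, 0 < η ∧
    ∀ (x₀ : EuclideanSpace ℝ (Fin n)) (x : ℝ → EuclideanSpace ℝ (Fin n)),
      IsShortMemorySolution α ω t₀ f x₀ x → ‖x₀ - p‖ < η →
        Tendsto x atTop (𝓝 p)

/-- Lyapunov asymptotic stability of `p`: stable and attractive. -/
def IsLyapunovAsymptoticallyStable {n : ℕ} (α ω t₀ : ℝ)
    (f : EuclideanSpace ℝ (Fin n) → ℝ → EuclideanSpace ℝ (Fin n))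
    (p : EuclideanSpace ℝ (Fin n)) : Prop :=
  IsLyapunovStable α ω t₀ f p ∧ IsAttractive α ω t₀ f p

end

open Set

/-! The Lyapunov function is V = ∑ yᵢ^(2^mᵢ)/2^mᵢ, and `evenPotential_le_exp` bounds V(x(t)) by the
barrier B(t) = V(x₀)e^(-μ(t-t₀)) for small μ > 0. Stability and attractivity follow at once.

The excess U = max(V(x) - B, 0) starts at 0. Its memory derivative is nonpositive almost everywhere.
Where U = 0, this is a fractional extremum principle. Where U > 0, convexity replaces V by its
tangent at x(t), whose memory derivative is controlled by the equation and the sign condition; for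
small μ the barrier decays slowly enough not to spoil the sign.

Finally, the memory derivative integrated over [t₀, T] is a positively weighted average of U over
the last window (`integral_memory_deriv`), so U vanishes there. -/

/-! ### The memory window as a convolution -/

theorem memoryStart_eq_max (t₀ ω t : ℝ) : memoryStart t₀ ω t = max t₀ (t - ω) := by
  unfold memoryStart
  split_ifs with h
  · exact (max_eq_left (by linarith)).symm
  · exact (max_eq_right (by linarith)).symm

theorem le_memoryStart (t₀ ω t : ℝ) : t₀ ≤ memoryStart t₀ ω t := by
  rw [memoryStart_eq_max]; exact le_max_left _ _

theorem sub_le_memoryStart (t₀ ω t : ℝ) : t - ω ≤ memoryStart t₀ ω t := by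
  rw [memoryStart_eq_max]; exact le_max_right _ _

theorem memoryStart_le {t₀ ω t : ℝ} (hω : 0 < ω) (ht : t₀ ≤ t) : memoryStart t₀ ω t ≤ t := by
  rw [memoryStart_eq_max]; exact max_le ht (by linarith)

/-- The memory kernel `s ^ (-α)`, truncated to `[0, ω)`. -/
noncomputable def memoryKernel (α ω : ℝ) : ℝ → ℝ := (Ico 0 ω).indicator fun s => s ^ (-α)

theorem intervalIntegrable_sub_rpow {α : ℝ} (hα₁ : α < 1) (t a b : ℝ) :
    IntervalIntegrable (fun τ => (t - τ) ^ (-α)) volume a b := by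
  have := (intervalIntegral.intervalIntegrable_rpow' (a := t - a) (b := t - b) (r := -α)
    (by linarith)).comp_sub_left t
  simpa using this

theorem integrable_memoryKernel {α ω : ℝ} (hα₁ : α < 1) (hω : 0 < ω) :
    Integrable (memoryKernel α ω) := by
  unfold memoryKernel
  rw [integrable_indicator_iff measurableSet_Ico]
  exact ((intervalIntegrable_iff_integrableOn_Ico_of_le hω.le).1
    (intervalIntegral.intervalIntegrable_rpow' (by linarith)))

/-- Inside `[t₀, T]` the convolution integrand of a function cut off to `(t₀, T]` with the memory
kernel is the integrand of the memory window. -/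
theorem indicator_mul_memoryKernel {α ω t₀ T t : ℝ} (ht : t ≤ T) (g : ℝ → ℝ) (τ : ℝ) :
    (Ioc t₀ T).indicator g τ * memoryKernel α ω (t - τ) =
      (Ioc (memoryStart t₀ ω t) t).indicator (fun τ => (t - τ) ^ (-α) * g τ) τ := by
  have h : τ ∈ Ioc (memoryStart t₀ ω t) t ↔ τ ∈ Ioc t₀ T ∧ t - τ ∈ Ico 0 ω := by
    rw [memoryStart_eq_max]
    simp only [mem_Ioc, mem_Ico, max_lt_iff]
    constructor
    · rintro ⟨⟨h1, h2⟩, h3⟩; exact ⟨⟨h1, by linarith⟩, by linarith, by linarith⟩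
    · rintro ⟨⟨h1, h2⟩, h3, h4⟩; exact ⟨⟨h1, by linarith⟩, by linarith⟩
  unfold memoryKernel
  by_cases h1 : τ ∈ Ioc t₀ T <;> by_cases h2 : t - τ ∈ Ico 0 ω <;>
    simp [indicator, h, h1, h2, mul_comm]

theorem integrable_indicator_deriv {g : ℝ → ℝ} {t₀ T : ℝ} (hT : t₀ ≤ T)
    (hg : AbsolutelyContinuousOnInterval g t₀ T) :
    Integrable ((Ioc t₀ T).indicator (deriv g)) := by
  rw [integrable_indicator_iff measurableSet_Ioc]
  exact (intervalIntegrable_iff_integrableOn_Ioc_of_le hT).1 hg.intervalIntegrable_deriv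

/-- The derivative is merely integrable and the kernel is singular at τ = t, but a convolution of
two L¹ functions exists almost everywhere. -/
theorem ae_intervalIntegrable_memory {α ω t₀ T : ℝ} (hα₁ : α < 1) (hω : 0 < ω) (hT : t₀ ≤ T)
    {g : ℝ → ℝ} (hg : AbsolutelyContinuousOnInterval g t₀ T) :
    ∀ᵐ t : ℝ, t ∈ Icc t₀ T →
      IntervalIntegrable (fun τ => (t - τ) ^ (-α) * deriv g τ) volume (memoryStart t₀ ω t) t := by
  filter_upwards [(integrable_indicator_deriv hT hg).ae_convolution_exists
    (ContinuousLinearMap.mul ℝ ℝ) (integrable_memoryKernel hα₁ hω)] with t h ht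
  rw [intervalIntegrable_iff_integrableOn_Ioc_of_le (memoryStart_le hω ht.1),
    ← integrable_indicator_iff measurableSet_Ioc]
  refine h.congr (ae_of_all _ fun τ => ?_)
  exact indicator_mul_memoryKernel ht.2 _ τ

theorem memory_convolution_eq {α ω t₀ T t : ℝ} (hω : 0 < ω) (ht : t ∈ Icc t₀ T) (g : ℝ → ℝ) :
    convolution ((Ioc t₀ T).indicator g) (memoryKernel α ω) (ContinuousLinearMap.mul ℝ ℝ) volume t =
      ∫ τ in memoryStart t₀ ω t..t, (t - τ) ^ (-α) * g τ := by
  rw [intervalIntegral.integral_of_le (memoryStart_le hω ht.1),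
    ← integral_indicator measurableSet_Ioc]
  exact integral_congr_ae (ae_of_all _ fun τ => indicator_mul_memoryKernel ht.2 g τ)

theorem indicator_convolution_indicator_deriv {g : ℝ → ℝ} {t₀ T τ : ℝ} (hτ : τ ∈ Icc t₀ T)
    (hg : AbsolutelyContinuousOnInterval g t₀ τ) :
    convolution ((Ico 0 (T - t₀)).indicator 1) ((Ioc t₀ T).indicator (deriv g))
      (ContinuousLinearMap.mul ℝ ℝ) volume τ = g τ - g t₀ := by
  rw [← hg.integral_deriv_eq_sub, intervalIntegral.integral_of_le hτ.1,
    ← integral_indicator measurableSet_Ioc, convolution_def,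
    ← integral_sub_left_eq_self _ volume τ]
  refine integral_congr_ae (ae_of_all _ fun s => ?_)
  have h : s ∈ Ioc t₀ τ ↔ s ∈ Ioc t₀ T ∧ τ - s ∈ Ico 0 (T - t₀) := by
    simp only [mem_Ioc, mem_Ico]
    obtain ⟨h1, h2⟩ := hτ
    constructor
    · rintro ⟨h3, h4⟩; exact ⟨⟨h3, by linarith⟩, by linarith, by linarith⟩
    · rintro ⟨⟨h3, h4⟩, h5, h6⟩; exact ⟨h3, by linarith⟩
  simp only [ContinuousLinearMap.mul_apply', sub_sub_cancel]
  by_cases h1 : s ∈ Ioc t₀ T <;> by_cases h2 : τ - s ∈ Ico 0 (T - t₀) <;>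
    simp [indicator, h, h1, h2]

/-- Integrating the memory derivative over `[t₀, T]` amounts to taking the memory average. -/
theorem integral_memory_deriv {α ω t₀ T : ℝ} (hα₁ : α < 1) (hω : 0 < ω) (hT : t₀ ≤ T)
    {g : ℝ → ℝ} (hg : AbsolutelyContinuousOnInterval g t₀ T) :
    ∫ τ in memoryStart t₀ ω T..T, (T - τ) ^ (-α) * (g τ - g t₀) =
      ∫ t in t₀..T, ∫ τ in memoryStart t₀ ω t..t, (t - τ) ^ (-α) * deriv g τ := by
  set w := (Ioc t₀ T).indicator (deriv g)
  set κ := memoryKernel α ω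
  set e : ℝ → ℝ := (Ico 0 (T - t₀)).indicator 1
  set L := ContinuousLinearMap.mul ℝ ℝ
  have hw : Integrable w := integrable_indicator_deriv hT hg
  have hκ : Integrable κ := integrable_memoryKernel hα₁ hω
  have he : Integrable e := by
    rw [integrable_indicator_iff measurableSet_Ico]
    exact integrableOn_const (by simp)
  have hcut : ∀ s ≤ T, convolution e w L volume s = (Ioc t₀ T).indicator (fun s => g s - g t₀) s := by
    intro s hs
    by_cases h : t₀ < s
    · rw [indicator_of_mem (mem_Ioc.2 ⟨h, hs⟩)]
      refine indicator_convolution_indicator_deriv ⟨h.le, hs⟩ (hg.mono ?_)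
      rw [uIcc_of_le h.le, uIcc_of_le hT]
      exact Icc_subset_Icc_right hs
    · rw [indicator_of_notMem (fun h' => h h'.1), convolution_def]
      refine integral_eq_zero_of_ae (ae_of_all _ fun u => ?_)
      by_cases hu : u ∈ Ico 0 (T - t₀)
      · have : s - u ∉ Ioc t₀ T := fun h' => h (by linarith [h'.1, hu.1])
        simp [w, this, L]
      · simp [e, hu, L]
  -- Convolution with e integrates from t₀ and convolution with κ takes the memory integral, so
  -- exchanging the two is associativity. It holds at the given point T because e is bounded and |w|
  -- ∗ |κ| is integrable.
  have hassoc : convolution (convolution e w L volume) κ L volume T =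
      convolution e (convolution w κ L volume) L volume T := by
    refine convolution_assoc L L L L (fun x y z => mul_assoc x y z) he.1 hw.1 hκ.1
      (he.ae_convolution_exists L hw) (hw.norm.ae_convolution_exists _ hκ.norm) ?_
    have hc : Integrable (convolution (fun x => ‖w x‖) (fun x => ‖κ x‖) L volume) :=
      hw.norm.integrable_convolution _ hκ.norm
    refine Integrable.bdd_mul (c := 1) (hc.comp_sub_left T) he.norm.1 (ae_of_all _ fun u => ?_)
    by_cases hu : u ∈ Ico 0 (T - t₀) <;> simp [e, hu]
  have hleft : convolution (convolution e w L volume) κ L volume T =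
      ∫ τ in memoryStart t₀ ω T..T, (T - τ) ^ (-α) * (g τ - g t₀) := by
    rw [← memory_convolution_eq (T := T) hω ⟨hT, le_rfl⟩, convolution_def, convolution_def]
    refine integral_congr_ae (ae_of_all _ fun s => ?_)
    by_cases hs : s ≤ T
    · simp only [hcut s hs]; rfl
    · have : T - s ∉ Ico 0 ω := fun h' => hs (by linarith [h'.1])
      simp [κ, memoryKernel, this, L]
  have hright : convolution e (convolution w κ L volume) L volume T =
      ∫ t in t₀..T, ∫ τ in memoryStart t₀ ω t..t, (t - τ) ^ (-α) * deriv g τ := by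
    rw [intervalIntegral.integral_of_le hT, ← integral_indicator measurableSet_Ioc,
      convolution_def, ← integral_sub_left_eq_self _ volume T]
    refine integral_congr_ae (ae_of_all _ fun s => ?_)
    simp only [sub_sub_cancel]
    by_cases hs : s ∈ Ioc t₀ T
    · have : T - s ∈ Ico 0 (T - t₀) := ⟨by linarith [hs.2], by linarith [hs.1]⟩
      rw [indicator_of_mem hs, ← memory_convolution_eq hω ⟨hs.1.le, hs.2⟩]
      simp [e, this, L, w, κ]
    · have : T - s ∉ Ico 0 (T - t₀) := fun h' => hs ⟨by linarith [h'.2], by linarith [h'.1]⟩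
      simp [e, this, hs, L]
  rw [← hleft, hassoc, hright]

/-- A nonnegative function that starts at zero and whose memory derivative is nonpositive
vanishes. -/
theorem eq_zero_of_memory_deriv_nonpos {α ω t₀ T : ℝ} (hα₁ : α < 1) (hω : 0 < ω) (hT : t₀ < T)
    {U : ℝ → ℝ} (hU : AbsolutelyContinuousOnInterval U t₀ T) (hU₀ : U t₀ = 0)
    (hnonneg : ∀ t, 0 ≤ U t)
    (hle : ∀ᵐ t : ℝ, t ∈ Icc t₀ T →
      ∫ τ in memoryStart t₀ ω t..t, (t - τ) ^ (-α) * deriv U τ ≤ 0) :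
    U T = 0 := by
  have hs : memoryStart t₀ ω T < T := by
    rw [memoryStart_eq_max]; exact max_lt hT (by linarith)
  have hcont : ContinuousOn U (Icc (memoryStart t₀ ω T) T) :=
    hU.continuousOn.mono (by rw [uIcc_of_le hT.le]; exact Icc_subset_Icc_left (le_memoryStart _ _ _))
  have hi : IntervalIntegrable (fun τ => (T - τ) ^ (-α) * U τ) volume (memoryStart t₀ ω T) T :=
    (intervalIntegrable_sub_rpow hα₁ _ _ _).mul_continuousOn (by rwa [uIcc_of_le hs.le])
  have hnn : ∀ᵐ τ ∂volume.restrict (Ioc (memoryStart t₀ ω T) T), 0 ≤ (T - τ) ^ (-α) * U τ := by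
    filter_upwards [ae_restrict_mem measurableSet_Ioc] with τ hτ
    exact mul_nonneg (Real.rpow_nonneg (by linarith [hτ.2]) _) (hnonneg τ)
  have hzero : ∫ τ in memoryStart t₀ ω T..T, (T - τ) ^ (-α) * U τ = 0 := by
    refine le_antisymm ?_ (intervalIntegral.integral_nonneg_of_ae_restrict hs.le ?_)
    · have := integral_memory_deriv hα₁ hω hT.le hU
      simp only [hU₀, sub_zero] at this
      rw [this, intervalIntegral.integral_of_le hT.le]
      refine integral_nonpos_of_ae ?_
      filter_upwards [ae_restrict_mem measurableSet_Ioc, ae_restrict_of_ae hle] with t ht h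
      exact h ⟨ht.1.le, ht.2⟩
    · rwa [restrict_Ioc_eq_restrict_Icc] at hnn
  have hae := (intervalIntegral.integral_eq_zero_iff_of_le_of_nonneg_ae hs.le hnn hi).1 hzero
  -- The kernel is positive for τ < T, so U vanishes almost everywhere on the window; continuity
  -- then reaches the endpoint T.
  have hUae : U =ᵐ[volume.restrict (Icc (memoryStart t₀ ω T) T)] fun _ => 0 := by
    rw [← restrict_Ioc_eq_restrict_Icc]
    have hne : ∀ᵐ τ ∂volume.restrict (Ioc (memoryStart t₀ ω T) T), τ ≠ T :=
      ae_restrict_of_ae (by simp [ae_iff, measure_singleton])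
    filter_upwards [hae, ae_restrict_mem measurableSet_Ioc, hne] with τ h hτ hτT
    have : 0 < T - τ := sub_pos.2 (lt_of_le_of_ne hτ.2 hτT)
    exact (mul_eq_zero.1 h).resolve_left (Real.rpow_pos_of_pos this _).ne'
  exact Measure.eqOn_Icc_of_ae_eq volume hs.ne hUae hcont continuousOn_const ⟨hs.le, le_rfl⟩

/-! ### Operations on absolutely continuous functions -/

theorem AbsolutelyContinuousOnInterval.lipschitz_comp {h g : ℝ → ℝ} {K : NNReal} {a b : ℝ}
    (hh : LipschitzWith K h) (hg : AbsolutelyContinuousOnInterval g a b) :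
    AbsolutelyContinuousOnInterval (fun t => h (g t)) a b := by
  unfold AbsolutelyContinuousOnInterval at hg ⊢
  refine squeeze_zero (fun E => Finset.sum_nonneg fun i _ => dist_nonneg) (fun E => ?_)
    (by simpa using hg.const_mul (K : ℝ))
  rw [Finset.mul_sum]
  exact Finset.sum_le_sum fun i _ => hh.dist_le_mul _ _

theorem AbsolutelyContinuousOnInterval.of_const (c a b : ℝ) :
    AbsolutelyContinuousOnInterval (fun _ => c) a b :=
  contDiff_const.contDiffOn.absolutelyContinuousOnInterval

theorem AbsolutelyContinuousOnInterval.fun_pow {g : ℝ → ℝ} {a b : ℝ}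
    (hg : AbsolutelyContinuousOnInterval g a b) (N : ℕ) :
    AbsolutelyContinuousOnInterval (fun t => g t ^ N) a b := by
  induction N with
  | zero => simpa using AbsolutelyContinuousOnInterval.of_const 1 a b
  | succ N ih => simpa only [pow_succ] using ih.fun_mul hg

theorem AbsolutelyContinuousOnInterval.fun_sum {ι : Type*} (s : Finset ι) {g : ι → ℝ → ℝ} {a b : ℝ}
    (hg : ∀ i, AbsolutelyContinuousOnInterval (g i) a b) :
    AbsolutelyContinuousOnInterval (fun t => ∑ i ∈ s, g i t) a b := by
  classical
  induction s using Finset.induction_on with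
  | empty => simpa using AbsolutelyContinuousOnInterval.of_const 0 a b
  | insert i s hi ih => simpa only [Finset.sum_insert hi] using (hg i).fun_add ih

/-! ### Fractional extremum and comparison principles -/

theorem hasDerivAt_shifted_kernel {α ε t τ : ℝ} (hτ : 0 < t - τ + ε) :
    HasDerivAt (fun τ => (t - τ + ε) ^ (-α)) (α * (t - τ + ε) ^ (-α - 1)) τ := by
  have h1 : HasDerivAt (fun τ => t - τ + ε) (-1) τ :=
    ((hasDerivAt_id τ).const_sub t).add_const ε
  convert h1.rpow_const (p := -α) (Or.inl hτ.ne') using 1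
  ring

/-- Integrate by parts: the boundary term at t vanishes with G, and the others have the right sign
because the kernel is positive and increasing in τ. The shift ε keeps it smooth up to τ = t. -/
theorem integral_shifted_kernel_mul_deriv_nonpos {α ε a t : ℝ} (hα₀ : 0 < α) (hε : 0 < ε)
    (hat : a ≤ t) {G : ℝ → ℝ} (hG : AbsolutelyContinuousOnInterval G a t) (hGt : G t = 0)
    (hG₀ : ∀ τ ∈ Icc a t, 0 ≤ G τ) :
    ∫ τ in a..t, (t - τ + ε) ^ (-α) * deriv G τ ≤ 0 := by
  have hpos : ∀ τ ∈ uIcc a t, 0 < t - τ + ε := by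
    intro τ hτ
    rw [uIcc_of_le hat] at hτ
    linarith [hτ.2]
  have hac : AbsolutelyContinuousOnInterval (fun τ => (t - τ + ε) ^ (-α)) a t := by
    refine ContDiffOn.absolutelyContinuousOnInterval ?_
    exact ContDiffOn.rpow_const_of_ne (by fun_prop) fun τ hτ => (hpos τ hτ).ne'
  rw [hac.integral_mul_deriv_eq_deriv_mul hG, hGt, mul_zero]
  have h1 : 0 ≤ (t - a + ε) ^ (-α) * G a :=
    mul_nonneg (Real.rpow_nonneg (by linarith) _) (hG₀ a ⟨le_rfl, hat⟩)
  have h2 : 0 ≤ ∫ τ in a..t, deriv (fun τ => (t - τ + ε) ^ (-α)) τ * G τ := by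
    refine intervalIntegral.integral_nonneg hat fun τ hτ => ?_
    have hp := hpos τ (by rwa [uIcc_of_le hat])
    rw [(hasDerivAt_shifted_kernel hp).deriv]
    exact mul_nonneg (mul_nonneg hα₀.le (Real.rpow_nonneg hp.le _)) (hG₀ τ hτ)
  linarith

/-- A nonnegative function has nonpositive memory derivative at a zero. -/
theorem integral_kernel_mul_deriv_nonpos {α a t : ℝ} (hα₀ : 0 < α) (hat : a ≤ t)
    {G : ℝ → ℝ} (hG : AbsolutelyContinuousOnInterval G a t) (hGt : G t = 0)
    (hG₀ : ∀ τ ∈ Icc a t, 0 ≤ G τ)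
    (hi : IntervalIntegrable (fun τ => (t - τ) ^ (-α) * deriv G τ) volume a t) :
    ∫ τ in a..t, (t - τ) ^ (-α) * deriv G τ ≤ 0 := by
  have hne : ∀ᵐ τ : ℝ, τ ≠ t := by simp [ae_iff, measure_singleton]
  -- Since s^(-α) decreases, the unshifted integrand dominates the shifted ones.
  have hlim : Tendsto (fun ε : ℝ => ∫ τ in a..t, (t - τ + ε) ^ (-α) * deriv G τ) (𝓝[>] 0)
      (𝓝 (∫ τ in a..t, (t - τ) ^ (-α) * deriv G τ)) := by
    refine intervalIntegral.tendsto_integral_filter_of_dominated_convergence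
      (fun τ => ‖(t - τ) ^ (-α) * deriv G τ‖) ?_ ?_ hi.norm ?_
    · refine Eventually.of_forall fun ε => AEStronglyMeasurable.mul ?_ ?_
      · exact Measurable.aestronglyMeasurable (by fun_prop)
      · exact (measurable_deriv G).aestronglyMeasurable
    · filter_upwards [self_mem_nhdsWithin] with ε hε
      have hε' : 0 < ε := hε
      filter_upwards [hne] with τ hτ hmem
      rw [uIoc_of_le hat] at hmem
      have h0 : 0 < t - τ := sub_pos.2 (lt_of_le_of_ne hmem.2 hτ)
      rw [norm_mul, norm_mul]
      refine mul_le_mul_of_nonneg_right ?_ (norm_nonneg _)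
      rw [Real.norm_of_nonneg (Real.rpow_nonneg (by linarith) _),
        Real.norm_of_nonneg (Real.rpow_nonneg h0.le _)]
      exact Real.rpow_le_rpow_of_nonpos h0 (by linarith) (by linarith)
    · filter_upwards [hne] with τ hτ hmem
      rw [uIoc_of_le hat] at hmem
      have h0 : 0 < t - τ := sub_pos.2 (lt_of_le_of_ne hmem.2 hτ)
      refine Tendsto.mul_const _ (tendsto_nhdsWithin_of_tendsto_nhds ?_)
      have : ContinuousAt (fun ε : ℝ => (t - τ + ε) ^ (-α)) 0 :=
        ContinuousAt.rpow_const (by fun_prop) (Or.inl (by simpa using h0.ne'))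
      simpa [ContinuousAt] using this
  refine le_of_tendsto hlim ?_
  filter_upwards [self_mem_nhdsWithin] with ε hε
  exact integral_shifted_kernel_mul_deriv_nonpos hα₀ hε hat hG hGt hG₀

/-- If `Y` touches `U` from below at the final time then it has the larger memory derivative. -/
theorem integral_kernel_mul_deriv_le {α a t : ℝ} (hα₀ : 0 < α) (hat : a ≤ t)
    {U Y : ℝ → ℝ} (hU : AbsolutelyContinuousOnInterval U a t)
    (hY : AbsolutelyContinuousOnInterval Y a t)
    (hUY : ∀ τ ∈ Icc a t, Y τ - Y t ≤ U τ - U t)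
    (hiU : IntervalIntegrable (fun τ => (t - τ) ^ (-α) * deriv U τ) volume a t)
    (hiY : IntervalIntegrable (fun τ => (t - τ) ^ (-α) * deriv Y τ) volume a t) :
    ∫ τ in a..t, (t - τ) ^ (-α) * deriv U τ ≤ ∫ τ in a..t, (t - τ) ^ (-α) * deriv Y τ := by
  set G : ℝ → ℝ := fun τ => U τ - Y τ - (U t - Y t) with hGdef
  have hG : AbsolutelyContinuousOnInterval G a t :=
    (hU.fun_sub hY).fun_sub (AbsolutelyContinuousOnInterval.of_const _ a t)
  have hd : ∀ᵐ τ : ℝ, τ ∈ uIoc a t → (t - τ) ^ (-α) * deriv U τ - (t - τ) ^ (-α) * deriv Y τ =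
      (t - τ) ^ (-α) * deriv G τ := by
    filter_upwards [hU.ae_differentiableAt, hY.ae_differentiableAt] with τ h1 h2 hτ
    have h1 := h1 (uIoc_subset_uIcc hτ)
    have h2 := h2 (uIoc_subset_uIcc hτ)
    rw [((h1.hasDerivAt.fun_sub h2.hasDerivAt).sub_const (U t - Y t)).deriv]
    ring
  have hi := (hiU.sub hiY).congr_ae ((ae_restrict_iff' measurableSet_uIoc).2 hd)
  have := integral_kernel_mul_deriv_nonpos hα₀ hat hG (by simp [hGdef])
    (fun τ hτ => by linarith [hUY τ hτ]) hi
  rw [← intervalIntegral.integral_congr_ae hd, intervalIntegral.integral_sub hiU hiY] at this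
  linarith

/-! ### The convex Lyapunov function -/

theorem even_pow_tangent_le {N : ℕ} (hN : Even N) (a b : ℝ) :
    N * b ^ (N - 1) * (a - b) ≤ a ^ N - b ^ N := by
  have hc : ConvexOn ℝ univ fun x : ℝ => x ^ N := hN.convexOn_pow
  have hd : HasDerivAt (fun x : ℝ => x ^ N) (N * b ^ (N - 1)) b := hasDerivAt_pow N b
  rcases lt_trichotomy a b with h | h | h
  · have := hc.slope_le_of_hasDerivAt (mem_univ a) (mem_univ b) h hd
    rw [slope_def_field, div_le_iff₀ (by linarith)] at this
    linarith
  · simp [h]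
  · have := hc.le_slope_of_hasDerivAt (mem_univ b) (mem_univ a) h hd
    rwa [slope_def_field, le_div_iff₀ (by linarith)] at this

/-- The polynomial Lyapunov function `∑ yᵢ ^ (2 ^ mᵢ) / 2 ^ mᵢ`. -/
noncomputable def evenPotential {n : ℕ} (m : Fin n → ℕ) (y : EuclideanSpace ℝ (Fin n)) : ℝ :=
  ∑ i, y i ^ (2 ^ m i) / 2 ^ m i

theorem even_two_pow {k : ℕ} (hk : 0 < k) : Even (2 ^ k) :=
  (Nat.even_pow' hk.ne').2 even_two

theorem evenPotential_term_nonneg {k : ℕ} (hk : 0 < k) (a : ℝ) :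
    0 ≤ a ^ (2 ^ k) / (2 : ℝ) ^ k :=
  div_nonneg ((even_two_pow hk).pow_nonneg a) (by positivity)

section
variable {n : ℕ} {m : Fin n → ℕ}

theorem evenPotential_nonneg (hm : ∀ i, 0 < m i) (y : EuclideanSpace ℝ (Fin n)) :
    0 ≤ evenPotential m y :=
  Finset.sum_nonneg fun i _ => evenPotential_term_nonneg (hm i) _

theorem continuous_evenPotential : Continuous (evenPotential m) := by
  unfold evenPotential
  fun_prop

theorem evenPotential_zero : evenPotential m 0 = 0 := by
  simp [evenPotential]

theorem evenPotential_le_sum (hm : ∀ i, 0 < m i) (y : EuclideanSpace ℝ (Fin n)) :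
    evenPotential m y ≤ ∑ i, y i ^ (2 ^ m i) :=
  Finset.sum_le_sum fun i _ =>
    div_le_self ((even_two_pow (hm i)).pow_nonneg _) (one_le_pow₀ one_le_two)

/-- The normalisation by 2^mᵢ makes the gradient exactly the multipliers zᵢ^(2^mᵢ-1) of the sign
condition. -/
theorem evenPotential_tangent_le (hm : ∀ i, 0 < m i) (y z : EuclideanSpace ℝ (Fin n)) :
    ∑ i, z i ^ (2 ^ m i - 1) * (y i - z i) ≤ evenPotential m y - evenPotential m z := by
  unfold evenPotential
  rw [← Finset.sum_sub_distrib]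
  refine Finset.sum_le_sum fun i _ => ?_
  have h := even_pow_tangent_le (even_two_pow (hm i)) (y i) (z i)
  rw [← sub_div, le_div_iff₀ (by positivity)]
  push_cast at h
  linarith

/-- The polynomial Lyapunov function is small only near the origin. -/
theorem tendsto_zero_of_evenPotential (hm : ∀ i, 0 < m i) {ι : Type*} {l : Filter ι}
    {y : ι → EuclideanSpace ℝ (Fin n)}
    (hy : Tendsto (fun s => evenPotential m (y s)) l (𝓝 0)) : Tendsto y l (𝓝 0) := by
  have hcoord : ∀ i, Tendsto (fun s => y s i) l (𝓝 0) := by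
    intro i
    have hle : ∀ s, y s i ^ (2 ^ m i) ≤ 2 ^ m i * evenPotential m (y s) := by
      intro s
      have := Finset.single_le_sum (f := fun i => y s i ^ (2 ^ m i) / (2 : ℝ) ^ m i)
        (fun i _ => evenPotential_term_nonneg (hm i) _) (Finset.mem_univ i)
      rw [div_le_iff₀ (by positivity)] at this
      unfold evenPotential
      linarith
    have hpow : Tendsto (fun s => y s i ^ (2 ^ m i)) l (𝓝 0) :=
      squeeze_zero (fun s => (even_two_pow (hm i)).pow_nonneg _) hle
        (by simpa using hy.const_mul ((2 : ℝ) ^ m i))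
    rw [Metric.tendsto_nhds] at hpow ⊢
    intro ε hε
    filter_upwards [hpow (ε ^ (2 ^ m i)) (by positivity)] with s hs
    rw [dist_zero_right, norm_pow] at hs
    rw [dist_zero_right]
    exact lt_of_pow_lt_pow_left₀ _ hε.le hs
  have h := tendsto_pi_nhds.2 hcoord
  have h2 := ((PiLp.continuous_toLp 2 fun _ : Fin n => ℝ).tendsto 0).comp h
  simpa [Function.comp_def] using h2

end

/-! ### The exponential barrier -/

theorem integral_sub_rpow_le {α ω a t : ℝ} (hα₁ : α < 1) (hat : a ≤ t) (hω : t - ω ≤ a) :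
    ∫ τ in a..t, (t - τ) ^ (-α) ≤ ω ^ (1 - α) / (1 - α) := by
  have h := intervalIntegral.integral_comp_sub_left (fun s : ℝ => s ^ (-α)) t (a := a) (b := t)
  rw [h, sub_self, integral_rpow (Or.inl (by linarith)), Real.zero_rpow (by linarith), sub_zero,
    show -α + 1 = 1 - α by ring]
  exact div_le_div_of_nonneg_right
    (Real.rpow_le_rpow (by linarith) (by linarith) (by linarith)) (by linarith)

theorem deriv_exp_barrier (b μ t₀ τ : ℝ) :
    deriv (fun τ => b * Real.exp (-μ * (τ - t₀))) τ = -μ * (b * Real.exp (-μ * (τ - t₀))) := by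
  have h : HasDerivAt (fun τ => -μ * (τ - t₀)) (-μ) τ := by
    simpa using ((hasDerivAt_id τ).sub_const t₀).const_mul (-μ)
  rw [(h.exp.const_mul b).deriv]
  ring

/-- The memory derivative of a decaying exponential is controlled by its current value. -/
theorem neg_le_integral_deriv_exp_barrier {α ω a b μ t t₀ : ℝ} (hα₁ : α < 1)
    (hb : 0 ≤ b) (hμ : 0 ≤ μ) (hat : a ≤ t) (hω : t - ω ≤ a) :
    -(μ * Real.exp (μ * ω) * (ω ^ (1 - α) / (1 - α)) * (b * Real.exp (-μ * (t - t₀)))) ≤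
      ∫ τ in a..t, (t - τ) ^ (-α) * deriv (fun τ => b * Real.exp (-μ * (τ - t₀))) τ := by
  simp only [deriv_exp_barrier]
  set C := μ * Real.exp (μ * ω) * (b * Real.exp (-μ * (t - t₀)))
  have hC : 0 ≤ C := by positivity
  have hle : ∫ τ in a..t, (t - τ) ^ (-α) * -C ≤
      ∫ τ in a..t, (t - τ) ^ (-α) * (-μ * (b * Real.exp (-μ * (τ - t₀)))) := by
    refine intervalIntegral.integral_mono_on hat
      ((intervalIntegrable_sub_rpow hα₁ t a t).mul_const _)
      ((intervalIntegrable_sub_rpow hα₁ t a t).mul_continuousOn (by fun_prop)) fun τ hτ => ?_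
    refine mul_le_mul_of_nonneg_left ?_ (Real.rpow_nonneg (by linarith [hτ.2]) _)
    -- Within the window t - τ ≤ ω, so past values exceed the current one by at most the factor
    -- e^(μω).
    have hexp : Real.exp (-μ * (τ - t₀)) ≤ Real.exp (μ * ω) * Real.exp (-μ * (t - t₀)) := by
      rw [← Real.exp_add, Real.exp_le_exp]
      nlinarith [hτ.1]
    have := mul_le_mul_of_nonneg_left hexp (mul_nonneg hμ hb)
    simp only [C]
    nlinarith
  refine le_trans ?_ hle
  rw [intervalIntegral.integral_mul_const]
  have := mul_le_mul_of_nonneg_right (integral_sub_rpow_le hα₁ hat hω) hC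
  simp only [C] at this ⊢
  nlinarith

theorem exists_decay_rate {ω c K : ℝ} (hc : 0 < c) :
    ∃ μ : ℝ, 0 < μ ∧ μ * Real.exp (μ * ω) * K ≤ c := by
  have h : Tendsto (fun μ : ℝ => μ * Real.exp (μ * ω) * K) (𝓝[>] 0) (𝓝 0) := by
    refine tendsto_nhdsWithin_of_tendsto_nhds ?_
    have : Continuous fun μ : ℝ => μ * Real.exp (μ * ω) * K := by fun_prop
    simpa using this.tendsto 0
  obtain ⟨μ, hμ, hle⟩ := ((eventually_mem_nhdsWithin (a := (0 : ℝ)) (s := Ioi 0)).and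
    (h.eventually_le_const hc)).exists
  exact ⟨μ, hμ, hle⟩

/-! ### Decay along solutions and conclusion -/

theorem integral_kernel_mul_deriv_sum_sub {n : ℕ} {α a t : ℝ} (hα₁ : α < 1) (c : Fin n → ℝ)
    {g : Fin n → ℝ → ℝ} {B : ℝ → ℝ} (hB : ContDiff ℝ 1 B)
    (hg : ∀ i, AbsolutelyContinuousOnInterval (g i) a t)
    (hi : ∀ i, IntervalIntegrable (fun τ => (t - τ) ^ (-α) * deriv (g i) τ) volume a t) :
    IntervalIntegrable
      (fun τ => (t - τ) ^ (-α) * deriv (fun τ => ∑ i, c i * g i τ - B τ) τ) volume a t ∧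
    ∫ τ in a..t, (t - τ) ^ (-α) * deriv (fun τ => ∑ i, c i * g i τ - B τ) τ =
      ∑ i, c i * (∫ τ in a..t, (t - τ) ^ (-α) * deriv (g i) τ) -
        ∫ τ in a..t, (t - τ) ^ (-α) * deriv B τ := by
  have hiB : IntervalIntegrable (fun τ => (t - τ) ^ (-α) * deriv B τ) volume a t :=
    (intervalIntegrable_sub_rpow hα₁ t a t).mul_continuousOn
      (hB.continuous_deriv le_rfl).continuousOn
  have hic : ∀ i ∈ Finset.univ, IntervalIntegrable
      (fun τ => c i * ((t - τ) ^ (-α) * deriv (g i) τ)) volume a t :=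
    fun i _ => (hi i).const_mul (c i)
  have hisum := IntervalIntegrable.sum Finset.univ hic
  have hd : ∀ᵐ τ : ℝ, τ ∈ uIoc a t →
      ∑ i, c i * ((t - τ) ^ (-α) * deriv (g i) τ) - (t - τ) ^ (-α) * deriv B τ =
        (t - τ) ^ (-α) * deriv (fun τ => ∑ i, c i * g i τ - B τ) τ := by
    filter_upwards [ae_all_iff.2 fun i => (hg i).ae_differentiableAt] with τ h hτ
    have h1 : HasDerivAt (fun τ => ∑ i, c i * g i τ) (∑ i, c i * deriv (g i) τ) τ :=
      HasDerivAt.fun_sum fun i _ =>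
        ((h i (uIoc_subset_uIcc hτ)).hasDerivAt.const_mul (c i))
    rw [(h1.fun_sub ((hB.differentiable one_ne_zero) τ).hasDerivAt).deriv, mul_sub, Finset.mul_sum]
    congr 1
    exact Finset.sum_congr rfl fun i _ => by ring
  have hisum' : IntervalIntegrable
      (fun τ => ∑ i, c i * ((t - τ) ^ (-α) * deriv (g i) τ)) volume a t := by
    simpa only [Finset.sum_apply] using hisum.congr_ae (ae_of_all _ fun τ => Finset.sum_apply _ _ _)
  refine ⟨(hisum'.sub hiB).congr_ae ((ae_restrict_iff' measurableSet_uIoc).2 hd), ?_⟩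
  rw [← intervalIntegral.integral_congr_ae hd, intervalIntegral.integral_sub hisum' hiB,
    intervalIntegral.integral_finsetSum hic]
  simp only [intervalIntegral.integral_const_mul]

/-- Along solutions the Lyapunov function stays below a decaying exponential. -/
theorem evenPotential_le_exp {n : ℕ} {α ω t₀ φ μ : ℝ} (hα₀ : 0 < α) (hα₁ : α < 1) (hω : 0 < ω)
    {f : EuclideanSpace ℝ (Fin n) → ℝ → EuclideanSpace ℝ (Fin n)}
    (hφ : 0 < φ) {m : Fin n → ℕ} (hm : ∀ i, 0 < m i)
    (hζ : ∀ (x : EuclideanSpace ℝ (Fin n)) (t : ℝ), t₀ ≤ t →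
      ∑ i, x i ^ (2 ^ m i - 1) * f x t i ≤ -φ * ∑ i, x i ^ (2 ^ m i))
    (hμ : 0 < μ)
    (hμφ : μ * Real.exp (μ * ω) * (ω ^ (1 - α) / (1 - α)) ≤ Real.Gamma (1 - α) * φ)
    {x₀ : EuclideanSpace ℝ (Fin n)} {x : ℝ → EuclideanSpace ℝ (Fin n)}
    (hx : IsShortMemorySolution α ω t₀ f x₀ x) {T : ℝ} (hT : t₀ ≤ T) :
    evenPotential m (x T) ≤ evenPotential m x₀ * Real.exp (-μ * (T - t₀)) := by
  rcases hT.eq_or_lt with rfl | hlt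
  · simp [hx.initial]
  set b := evenPotential m x₀
  have hb : 0 ≤ b := evenPotential_nonneg hm x₀
  have hΓ : 0 < Real.Gamma (1 - α) := Real.Gamma_pos_of_pos (by linarith)
  set B : ℝ → ℝ := fun τ => b * Real.exp (-μ * (τ - t₀)) with hBdef
  have hB : ContDiff ℝ 1 B := by fun_prop
  have hxT := hx.absolutelyContinuous T hT
  set z : ℝ → ℝ := fun τ => evenPotential m (x τ) - B τ with hzdef
  set U : ℝ → ℝ := fun τ => max (z τ) 0 with hUdef
  have hz : AbsolutelyContinuousOnInterval z t₀ T := by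
    refine AbsolutelyContinuousOnInterval.fun_sub ?_ hB.contDiffOn.absolutelyContinuousOnInterval
    unfold evenPotential
    refine AbsolutelyContinuousOnInterval.fun_sum _ fun i => ?_
    simp only [div_eq_inv_mul]
    exact ((hxT i).fun_pow _).const_mul _
  have hU : AbsolutelyContinuousOnInterval U t₀ T :=
    hz.lipschitz_comp (h := fun s => max s 0) (LipschitzWith.id.max_const 0)
  have hU₀ : U t₀ = 0 := by simp [hUdef, hzdef, hBdef, hx.initial, b]
  suffices h : U T = 0 by
    have : z T ≤ U T := le_max_left _ _
    simp only [hzdef] at this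
    linarith
  refine eq_zero_of_memory_deriv_nonpos hα₁ hω hlt hU hU₀ (fun t => le_max_right _ _) ?_
  filter_upwards [hx.equation, ae_intervalIntegrable_memory hα₁ hω hT hU,
    ae_all_iff.2 fun i => ae_intervalIntegrable_memory hα₁ hω hT (hxT i)] with t heq hiU hix ht
  have hiU := hiU ht
  have hix := fun i => hix i ht
  have hst := memoryStart_le hω ht.1
  have hsub : uIcc (memoryStart t₀ ω t) t ⊆ uIcc t₀ T := by
    rw [uIcc_of_le hst, uIcc_of_le hT]
    exact Icc_subset_Icc (le_memoryStart _ _ _) ht.2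
  rcases le_or_gt (z t) 0 with hzt | hzt
  · exact integral_kernel_mul_deriv_nonpos hα₀ hst (hU.mono hsub) (max_eq_right hzt)
      (fun τ _ => le_max_right _ _) hiU
  · set c : Fin n → ℝ := fun i => x t i ^ (2 ^ m i - 1) with hc
    -- Up to a constant, V is replaced by its tangent at x(t): with c frozen at time t, the memory
    -- derivative of Y is linear in those of the components.
    set Y : ℝ → ℝ := fun τ => ∑ i, c i * x τ i - B τ with hYdef
    obtain ⟨hiY, hYeq⟩ := integral_kernel_mul_deriv_sum_sub hα₁ c hB
      (fun i => (hxT i).mono hsub) hix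
    have hY : AbsolutelyContinuousOnInterval Y (memoryStart t₀ ω t) t :=
      (AbsolutelyContinuousOnInterval.fun_sum _ fun i => ((hxT i).mono hsub).const_mul _).fun_sub
        hB.contDiffOn.absolutelyContinuousOnInterval
    refine (integral_kernel_mul_deriv_le hα₀ hst (hU.mono hsub) hY (fun τ _ => ?_) hiU hiY).trans ?_
    -- Convexity gives Y τ - Y t ≤ z τ - z t, and U ≥ z with equality at t.
    · have h1 : z τ ≤ U τ := le_max_left _ _
      have h2 : U t = z t := max_eq_left hzt.le
      have h3 := evenPotential_tangent_le hm (x τ) (x t)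
      simp only [mul_sub, Finset.sum_sub_distrib] at h3
      simp only [hYdef, hzdef, hc] at h1 h2 ⊢
      linarith
    · have hsol : ∀ i, ∫ τ in memoryStart t₀ ω t..t, (t - τ) ^ (-α) * deriv (fun τ => x τ i) τ =
          Real.Gamma (1 - α) * f (x t) t i := by
        intro i
        rw [← heq ht.1 i, shortMemoryDeriv]
        field_simp
      have hbar := neg_le_integral_deriv_exp_barrier (t₀ := t₀) hα₁ hb hμ.le hst
        (sub_le_memoryStart t₀ ω t)
      have hBt : 0 ≤ B t := by positivity
      have h1 : Real.Gamma (1 - α) * ∑ i, c i * f (x t) t i ≤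
          Real.Gamma (1 - α) * (-φ * evenPotential m (x t)) := by
        refine mul_le_mul_of_nonneg_left ((hζ (x t) t ht.1).trans ?_) hΓ.le
        nlinarith [evenPotential_le_sum hm (x t)]
      have h2 := mul_le_mul_of_nonneg_right hμφ hBt
      -- The bounds add up to -Γ(1-α)φ(V(x(t)) - B(t)), which is -Γ(1-α)φ z(t).
      have h3 : 0 ≤ Real.Gamma (1 - α) * φ * z t := by positivity
      rw [hYeq]
      simp only [hsol]
      have h4 : ∑ i, c i * (Real.Gamma (1 - α) * f (x t) t i) =
          Real.Gamma (1 - α) * ∑ i, c i * f (x t) t i := by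
        rw [Finset.mul_sum]
        exact Finset.sum_congr rfl fun i _ => by ring
      rw [h4]
      simp only [hzdef] at h3
      linarith

theorem theorem5 {n : ℕ} (hn : 0 < n) (α ω t₀ : ℝ) (hα₀ : 0 < α) (hα₁ : α < 1) (hω : 0 < ω)
    (f : EuclideanSpace ℝ (Fin n) → ℝ → EuclideanSpace ℝ (Fin n))
    (hf : ContinuousOn (fun q : EuclideanSpace ℝ (Fin n) × ℝ => f q.1 q.2)
      (Set.univ ×ˢ Set.Ici t₀))
    (heq : IsEquilibriumPoint t₀ f 0)
    (φ : ℝ) (hφ : 0 < φ) (m : Fin n → ℕ) (hm : ∀ i, 0 < m i)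
    (hζ : ∀ (x : EuclideanSpace ℝ (Fin n)) (t : ℝ), t₀ ≤ t →
      ∑ i, x i ^ (2 ^ m i - 1) * f x t i ≤ -φ * ∑ i, x i ^ (2 ^ m i))
    (hgain : φ * 2 ^ (⨅ i, m i) > 1 / (ω ^ α * Real.Gamma (1 - α))) :
    IsLyapunovAsymptoticallyStable α ω t₀ f 0 := by
  have hΓ : 0 < Real.Gamma (1 - α) := Real.Gamma_pos_of_pos (by linarith)
  obtain ⟨μ, hμ, hμφ⟩ := exists_decay_rate (ω := ω) (K := ω ^ (1 - α) / (1 - α)) (mul_pos hΓ hφ)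
  -- The radius 1 is arbitrary: the exponential bound holds for every initial value.
  refine ⟨fun ε hε => ?_, 1, one_pos, fun x₀ x hx _ => ?_⟩
  · have hsmall : Tendsto id (comap (evenPotential m) (𝓝 0)) (𝓝 0) :=
      tendsto_zero_of_evenPotential hm tendsto_comap
    obtain ⟨ρ, hρ, hVε⟩ := ((Metric.nhds_basis_ball.comap _).eventually_iff).1
      (hsmall.eventually (Metric.ball_mem_nhds 0 hε))
    obtain ⟨δ, hδ, hVδ⟩ := Metric.tendsto_nhds_nhds.1
      ((continuous_evenPotential (m := m)).tendsto 0) ρ hρ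
    refine ⟨δ, hδ, fun x₀ x hx hx₀ t ht => ?_⟩
    rw [← dist_eq_norm] at hx₀ ⊢
    have h0 := hVδ hx₀
    rw [evenPotential_zero, dist_zero_right, Real.norm_of_nonneg (evenPotential_nonneg hm _)] at h0
    refine hVε (x := x t) ?_
    rw [mem_preimage, Metric.mem_ball, dist_zero_right,
      Real.norm_of_nonneg (evenPotential_nonneg hm _)]
    refine lt_of_le_of_lt ((evenPotential_le_exp hα₀ hα₁ hω hφ hm hζ hμ hμφ hx ht).trans
      (mul_le_of_le_one_right (evenPotential_nonneg hm _) (Real.exp_le_one_iff.2 ?_))) h0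
    nlinarith
  · refine tendsto_zero_of_evenPotential hm ?_
    have hexp : Tendsto (fun t => evenPotential m x₀ * Real.exp (-μ * (t - t₀))) atTop (𝓝 0) := by
      have h1 : Tendsto (fun t => -μ * (t - t₀)) atTop atBot :=
        (tendsto_atTop_add_const_right atTop (-t₀) tendsto_id).const_mul_atTop_of_neg
          (neg_lt_zero.2 hμ)
      simpa using (Real.tendsto_exp_atBot.comp h1).const_mul (evenPotential m x₀)
    refine squeeze_zero' (Eventually.of_forall fun t => evenPotential_nonneg hm _) ?_ hexp
    filter_upwards [eventually_ge_atTop t₀] with t ht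
    exact evenPotential_le_exp hα₀ hα₁ hω hφ hm hζ hμ hμφ hx ht
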